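/- Let $n\ge 1$ and let $Q=(Q_{ij})_{1\le i,j\le n}$ be a random real symmetric matrix whose diagonal entries $(Q_{ii})_{1\le i\le n}$ and upper-triangular off-diagonal entries $(Q_{ij})_{1\le i<j\le n}$ are mutually independent. Assume that the diagonal entries are identically distributed, that the off-diagonal entries are identically distributed, and that both laws are absolutely continuous with respect to Lebesgue measure on $\mathbb R$. Let $C\subseteq\{1,\dots,n\}$ be a fixed nonempty set with $|C|\le 4$, and let $Q[C]$ be the principal submatrix of $Q$ with rows and columns indexed by $C$. Then, almost surely, the local doubly nonnegative (DNN) problem $$\min\bigl\{\langle Q[C],Y\rangle:\ Y\in\mathbb R^{C\times C},\ \langle E,Y\rangle=1,\ Y\succeq 0,\ Y\ge 0\bigr\}$$ has a unique optimizer, and that optimizer has rank one. Here $\langle Z,Y\rangle=\sum_{i,j}Z_{ij}Y_{ij}$, $E$ is the all-ones matrix, $Y\succeq0$ means that $Y$ is symmetric positive semidefinite, and $Y\ge0$ means that $Y$ is entrywise nonnegative. -/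

import Mathlib

open MeasureTheory ProbabilityTheory

/-- The all-ones matrix `E`. -/
def allOnes (ι : Type*) : Matrix ι ι ℝ := Matrix.of fun _ _ => 1

/-- The trace (Frobenius) inner product `⟨Z, Y⟩ = ∑ i, ∑ j, Z i j * Y i j`. -/
def matInner {ι : Type*} [Fintype ι] (Z Y : Matrix ι ι ℝ) : ℝ :=
  ∑ i, ∑ j, Z i j * Y i j

/-- The feasible set of the DNN problem: `⟨E, Y⟩ = 1`, `Y` is (symmetric and) positive
semidefinite, and `Y` is entrywise nonnegative. -/
def dnnFeasible (ι : Type*) [Fintype ι] : Set (Matrix ι ι ℝ) :=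
  {Y | matInner (allOnes ι) Y = 1 ∧ Y.PosSemidef ∧ ∀ i j, 0 ≤ Y i j}

/-- `Y` is an optimizer of the DNN problem
`min {⟨Z, Y⟩ : ⟨E, Y⟩ = 1, Y ⪰ 0, Y ≥ 0}` with data matrix `Z`. -/
def IsDNNOptimizer {ι : Type*} [Fintype ι] (Z Y : Matrix ι ι ℝ) : Prop :=
  Y ∈ dnnFeasible ι ∧ ∀ X ∈ dnnFeasible ι, matInner Z Y ≤ matInner Z X

/-- The principal submatrix `Q[C]`. -/
def principalSubmatrix {n : ℕ} (Q : Matrix (Fin n) (Fin n) ℝ) (C : Finset (Fin n)) :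
    Matrix C C ℝ :=
  Q.submatrix Subtype.val Subtype.val

/-- `Q` is a random symmetric matrix on `(Ω, P)` whose diagonal and upper-triangular entries are
mutually independent, whose diagonal entries all have law `lawD`, whose off-diagonal entries all
have law `lawO`, both laws being absolutely continuous with respect to Lebesgue measure. -/
structure IsMatrixGenerator {Ω : Type*} [MeasurableSpace Ω] (P : Measure Ω) {n : ℕ}
    (Q : Ω → Matrix (Fin n) (Fin n) ℝ) (lawD lawO : Measure ℝ) : Prop where
  symm : ∀ ω, (Q ω).IsSymm
  measurable_entry : ∀ i j, Measurable fun ω => Q ω i j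
  indep : iIndepFun (fun (p : {p : Fin n × Fin n // p.1 ≤ p.2}) ω => Q ω p.1.1 p.1.2) P
  law_diag : ∀ i, P.map (fun ω => Q ω i i) = lawD
  law_offDiag : ∀ i j, i < j → P.map (fun ω => Q ω i j) = lawO
  ac_diag : lawD ≪ volume
  ac_offDiag : lawO ≪ volume

open Matrix

section DoublyNonnegative

variable {ι : Type*} [Fintype ι]

theorem Matrix.PosSemidef.sq_dotProduct_mulVec_le {Y : Matrix ι ι ℝ} (hY : Y.PosSemidef)
    (v w : ι → ℝ) : (v ⬝ᵥ Y *ᵥ w) ^ 2 ≤ (v ⬝ᵥ Y *ᵥ v) * (w ⬝ᵥ Y *ᵥ w) := by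
  have hsymm : w ⬝ᵥ Y *ᵥ v = v ⬝ᵥ Y *ᵥ w := by
    have hT : Yᵀ = Y := by simpa using hY.isHermitian.eq
    rw [dotProduct_mulVec, ← mulVec_transpose, hT, dotProduct_comm]
  have h := discrim_le_zero (a := w ⬝ᵥ Y *ᵥ w) (b := 2 * (v ⬝ᵥ Y *ᵥ w)) (c := v ⬝ᵥ Y *ᵥ v)
    fun t => by
      have := hY.dotProduct_mulVec_nonneg (v + t • w)
      simp only [star_trivial, mulVec_add, mulVec_smul, dotProduct_add, add_dotProduct,
        smul_dotProduct, dotProduct_smul, smul_eq_mul, hsymm] at this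
      linarith
  rw [discrim] at h
  linarith

theorem Matrix.PosSemidef.sub_smul_vecMulVec {Y : Matrix ι ι ℝ} (hY : Y.PosSemidef)
    (w : ι → ℝ) {ε : ℝ} (hε : 0 ≤ ε) (h : ε * (w ⬝ᵥ Y *ᵥ w) ≤ 1) :
    (Y - ε • vecMulVec (Y *ᵥ w) (Y *ᵥ w)).PosSemidef := by
  refine .of_dotProduct_mulVec_nonneg (hY.isHermitian.sub ?_) fun v => ?_
  · ext i j
    simp [vecMulVec_apply, mul_comm]
  · have hcs := hY.sq_dotProduct_mulVec_le v w
    have hv : 0 ≤ v ⬝ᵥ Y *ᵥ v := by simpa using hY.dotProduct_mulVec_nonneg v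
    have : star v ⬝ᵥ (Y - ε • vecMulVec (Y *ᵥ w) (Y *ᵥ w)) *ᵥ v
        = v ⬝ᵥ Y *ᵥ v - ε * (v ⬝ᵥ Y *ᵥ w) ^ 2 := by
      simp only [star_trivial, sub_mulVec, smul_mulVec, vecMulVec_mulVec, dotProduct_sub,
        dotProduct_smul, smul_eq_mul, op_smul_eq_smul, dotProduct_comm (Y *ᵥ w) v]
      ring
    rw [this]
    nlinarith [mul_le_mul_of_nonneg_left hcs hε, mul_le_mul_of_nonneg_left h hv]

/-- A doubly nonnegative matrix stays doubly nonnegative after subtracting a small multiple of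
`x xᵀ`, when `x` is in its range and the support of `x` is a clique of its graph. -/
theorem exists_sub_smul_vecMulVec_doublyNonneg {Y : Matrix ι ι ℝ} (hY : Y.PosSemidef)
    (hnn : ∀ i j, 0 ≤ Y i j) (w : ι → ℝ)
    (hsupp : ∀ i j, Y i j = 0 → (Y *ᵥ w) i * (Y *ᵥ w) j = 0) :
    ∃ ε : ℝ, 0 < ε ∧ (Y - ε • vecMulVec (Y *ᵥ w) (Y *ᵥ w)).PosSemidef ∧
      ∀ i j, 0 ≤ (Y - ε • vecMulVec (Y *ᵥ w) (Y *ᵥ w)) i j := by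
  have small : ∀ a b : ℝ, 0 < b → ∀ᶠ ε : ℝ in nhdsWithin 0 (Set.Ioi 0), ε * a ≤ b := by
    intro a b hb
    have ht : Filter.Tendsto (fun ε : ℝ => ε * a) (nhdsWithin 0 (Set.Ioi 0)) (nhds 0) := by
      have : Filter.Tendsto (fun ε : ℝ => ε * a) (nhds 0) (nhds (0 * a)) :=
        (continuous_id.mul continuous_const).tendsto 0
      rw [zero_mul] at this
      exact this.mono_left nhdsWithin_le_nhds
    exact ht.eventually_le_const hb
  have h1 := small (w ⬝ᵥ Y *ᵥ w) 1 one_pos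
  have h2 : ∀ᶠ ε : ℝ in nhdsWithin 0 (Set.Ioi 0), ∀ i j,
      ε * ((Y *ᵥ w) i * (Y *ᵥ w) j) ≤ Y i j := by
    simp only [Filter.eventually_all]
    intro i j
    rcases (hnn i j).eq_or_lt with h | h
    · simp [hsupp i j h.symm, ← h]
    · exact small _ _ h
  have h0 : ∀ᶠ ε : ℝ in nhdsWithin 0 (Set.Ioi 0), 0 < ε := self_mem_nhdsWithin
  obtain ⟨ε, hε, h1, h2⟩ := (h0.and (h1.and h2)).exists
  refine ⟨ε, hε, hY.sub_smul_vecMulVec w (le_of_lt hε) h1, fun i j => ?_⟩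
  simpa [vecMulVec_apply] using h2 i j

theorem Matrix.PosSemidef.apply_eq_zero_of_diag {Y : Matrix ι ι ℝ} (hY : Y.PosSemidef) {i : ι}
    (h : Y i i = 0) (j : ι) : Y j i = 0 := by
  classical
  have : Y *ᵥ Pi.single i 1 = 0 :=
    (hY.dotProduct_mulVec_zero_iff _).1 (by simpa using h)
  simpa using congrFun this j

/-- In a doubly nonnegative matrix whose graph is the 4-cycle `p j q k`, some nonzero nonnegative
vector of the range is supported on the edge `p j`. -/
theorem exists_mulVec_supported_of_cycle {Y : Matrix ι ι ℝ} (hY : Y.PosSemidef) {p j q k : ι}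
    (hall : ∀ r, r = p ∨ r = j ∨ r = q ∨ r = k) (hpj : 0 < Y p j) (hjq : 0 < Y j q)
    (hqk : 0 < Y q k) (hpk : 0 < Y p k) (hpq : Y p q = 0) (hjk : Y j k = 0) :
    ∃ w : ι → ℝ, (∀ i, 0 ≤ (Y *ᵥ w) i) ∧ Y *ᵥ w ≠ 0 ∧
      ∀ a b, Y a b = 0 → (Y *ᵥ w) a * (Y *ᵥ w) b = 0 := by
  classical
  have hs : ∀ a b, Y a b = Y b a := fun a b => by simpa using hY.isHermitian.apply b a
  have hd : ∀ {a b}, 0 < Y a b → 0 < Y b b := fun {a b} h =>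
    hY.diag_nonneg.lt_of_ne fun h0 => h.ne' (hY.apply_eq_zero_of_diag h0.symm a)
  have hqq := hd hjq
  have hΔ : 0 < Y q q * Y k k - Y q k ^ 2 := by
    set v : ι → ℝ := Y q k • Pi.single q 1 - Y q q • Pi.single k 1
    have hv : v ⬝ᵥ Y *ᵥ v = Y q q * (Y q q * Y k k - Y q k ^ 2) := by
      simp only [v, mulVec_sub, mulVec_smul, sub_dotProduct, smul_dotProduct, dotProduct_sub,
        dotProduct_smul, mulVec_single_one, single_dotProduct, col_apply, smul_eq_mul, hs k q]
      ring
    have h0 : 0 ≤ v ⬝ᵥ Y *ᵥ v := by simpa using hY.dotProduct_mulVec_nonneg v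
    refine (nonneg_of_mul_nonneg_right (hv ▸ h0) hqq).lt_of_ne fun h => ?_
    have hker : Y *ᵥ v = 0 := (hY.dotProduct_mulVec_zero_iff v).1 (by simp [hv, ← h])
    have := congrFun hker j
    simp [v, mulVec_sub, mulVec_smul, hjk, hqk.ne', hjq.ne'] at this
  set w : ι → ℝ := (Y q q * Y k k - Y q k ^ 2) • Pi.single p 1 + (Y q k * Y p k) • Pi.single q 1
    - (Y q q * Y p k) • Pi.single k 1
  have hw : ∀ r, (Y *ᵥ w) r = (Y q q * Y k k - Y q k ^ 2) * Y r p + Y q k * Y p k * Y r q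
      - Y q q * Y p k * Y r k := fun r => by
    simp [w, mulVec_sub, mulVec_add, mulVec_smul]
  have hwq : (Y *ᵥ w) q = 0 := by rw [hw, hs q p, hpq]; ring
  have hwk : (Y *ᵥ w) k = 0 := by rw [hw, hs k p, hs k q]; ring
  have hwj : 0 < (Y *ᵥ w) j := by
    rw [hw, hs j p, hjk]
    have := mul_pos hΔ hpj
    have := mul_pos (mul_pos hqk hpk) hjq
    linarith
  have hwp : 0 ≤ (Y *ᵥ w) p := by
    have h0 : 0 ≤ w ⬝ᵥ Y *ᵥ w := by simpa using hY.dotProduct_mulVec_nonneg w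
    have : w ⬝ᵥ Y *ᵥ w = (Y q q * Y k k - Y q k ^ 2) * (Y *ᵥ w) p := by
      conv_lhs => enter [1]; simp only [w]
      rw [sub_dotProduct, add_dotProduct, smul_dotProduct, smul_dotProduct, smul_dotProduct]
      simp [hwq, hwk]
    exact nonneg_of_mul_nonneg_right (this ▸ h0) hΔ
  refine ⟨w, fun i => ?_, fun h => hwj.ne' (congrFun h j), fun a b hab => ?_⟩
  · rcases hall i with rfl | rfl | rfl | rfl
    exacts [hwp, hwj.le, hwq.ge, hwk.ge]
  · have hpp := hd (hs p j ▸ hpj)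
    have hjj := hd hpj
    rcases hall a with ha | ha | ha | ha <;> rcases hall b with hb | hb | hb | hb <;>
      subst ha <;> subst hb <;> first
      | (simp [hwq, hwk]; done)
      | exact absurd hab hpp.ne'
      | exact absurd hab hjj.ne'
      | exact absurd hab hpj.ne'
      | exact absurd hab (hs _ _ ▸ hpj.ne')

theorem exists_mulVec_supported_on_clique {Y : Matrix ι ι ℝ} (hcard : Fintype.card ι ≤ 4)
    (hY : Y.PosSemidef) (hnn : ∀ i j, 0 ≤ Y i j) (hne : Y ≠ 0) :
    ∃ w : ι → ℝ, (∀ i, 0 ≤ (Y *ᵥ w) i) ∧ Y *ᵥ w ≠ 0 ∧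
      ∀ a b, Y a b = 0 → (Y *ᵥ w) a * (Y *ᵥ w) b = 0 := by
  classical
  have hs : ∀ a b, Y a b = Y b a := fun a b => by simpa using hY.isHermitian.apply b a
  have hd : ∀ {a b}, 0 < Y a b → 0 < Y b b := fun {a b} h =>
    hY.diag_nonneg.lt_of_ne fun h0 => h.ne' (hY.apply_eq_zero_of_diag h0.symm a)
  by_cases hsimp : ∃ i, 0 < Y i i ∧ ∀ a b, 0 < Y i a → 0 < Y i b → 0 < Y a b
  · obtain ⟨i, hi, hcl⟩ := hsimp
    refine ⟨Pi.single i 1, fun a => by simpa using hnn a i,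
      fun h => hi.ne' (by simpa using congrFun h i), fun a b hab => ?_⟩
    simp only [mulVec_single_one, col_apply, mul_eq_zero]
    by_contra! h
    refine (hcl a b ?_ ?_).ne' hab
    exacts [hs a i ▸ (hnn a i).lt_of_ne h.1.symm, hs b i ▸ (hnn b i).lt_of_ne h.2.symm]
  · push Not at hsimp
    have key : ∀ i, 0 < Y i i → ∃ a b, 0 < Y i a ∧ 0 < Y i b ∧ Y a b = 0 ∧ a ≠ i ∧ b ≠ i ∧
        a ≠ b := fun i hi => by
      obtain ⟨a, b, ha, hb, hab⟩ := hsimp i hi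
      have hab : Y a b = 0 := le_antisymm hab (hnn a b)
      refine ⟨a, b, ha, hb, hab, ?_, ?_, ?_⟩
      · rintro rfl; exact hb.ne' hab
      · rintro rfl; exact ha.ne' (hs _ _ ▸ hab)
      · rintro rfl; exact (hd ha).ne' hab
    obtain ⟨i, hi⟩ : ∃ i, 0 < Y i i := by
      by_contra! h
      exact hne (by ext a b; exact hY.apply_eq_zero_of_diag (le_antisymm (h b) hY.diag_nonneg) a)
    obtain ⟨j, k, hij, hik, hjk, -, -, hjk'⟩ := key i hi
    obtain ⟨p, q, hjp, hjq, hpq, hpj', hqj', hpq'⟩ := key j (hd hij)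
    have hkp' : p ≠ k := by rintro rfl; exact hjp.ne' hjk
    have hkq' : q ≠ k := by rintro rfl; exact hjq.ne' hjk
    have hall : ∀ r, r = p ∨ r = j ∨ r = q ∨ r = k := fun r => by
      have h4 : ({p, j, q, k} : Finset ι).card = 4 := by
        rw [Finset.card_insert_of_notMem, Finset.card_insert_of_notMem,
          Finset.card_insert_of_notMem, Finset.card_singleton] <;> simp <;> tauto
      have := Finset.eq_univ_of_card _ (le_antisymm (Finset.card_le_univ _) (h4 ▸ hcard))
      have hr := this ▸ Finset.mem_univ r
      simpa using hr
    obtain ⟨r, s, hkr, hks, -, hrk, hsk, hrs⟩ := key k (hd hik)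
    have hrj : r ≠ j := by rintro rfl; exact hkr.ne' (hs _ _ ▸ hjk)
    have hsj : s ≠ j := by rintro rfl; exact hks.ne' (hs _ _ ▸ hjk)
    have hkpq : 0 < Y k p ∧ 0 < Y k q := by
      rcases hall r with h | h | h | h <;> rcases hall s with h' | h' | h' | h' <;> simp_all
    exact exists_mulVec_supported_of_cycle hY hall (hs j p ▸ hjp) hjq (hs k q ▸ hkpq.2)
      (hs k p ▸ hkpq.1) hpq hjk

theorem matInner_add (Z X Y : Matrix ι ι ℝ) :
    matInner Z (X + Y) = matInner Z X + matInner Z Y := by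
  simp [matInner, mul_add, Finset.sum_add_distrib]

theorem matInner_smul (c : ℝ) (Z Y : Matrix ι ι ℝ) :
    matInner Z (c • Y) = c * matInner Z Y := by
  simp [matInner, Finset.mul_sum, mul_left_comm]

theorem matInner_allOnes (Y : Matrix ι ι ℝ) : matInner (allOnes ι) Y = ∑ i, ∑ j, Y i j := by
  simp [matInner, allOnes]

theorem smul_mem_dnnFeasible {R : Matrix ι ι ℝ} (hR : R.PosSemidef) (hnn : ∀ i j, 0 ≤ R i j)
    (h : 0 < matInner (allOnes ι) R) :
    (matInner (allOnes ι) R)⁻¹ • R ∈ dnnFeasible ι := by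
  refine ⟨?_, hR.smul (inv_nonneg.2 h.le), fun i j => ?_⟩
  · rw [matInner_smul, inv_mul_cancel₀ h.ne']
  · exact mul_nonneg (inv_nonneg.2 h.le) (hnn i j)

theorem IsDNNOptimizer.mul_le_matInner {Z Y : Matrix ι ι ℝ} (hY : IsDNNOptimizer Z Y)
    {R : Matrix ι ι ℝ} (hR : R.PosSemidef) (hnn : ∀ i j, 0 ≤ R i j) :
    matInner (allOnes ι) R * matInner Z Y ≤ matInner Z R := by
  have h0 : 0 ≤ matInner (allOnes ι) R := by
    rw [matInner_allOnes]
    exact Finset.sum_nonneg fun i _ => Finset.sum_nonneg fun j _ => hnn i j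
  rcases h0.eq_or_lt with h | h
  · have hR0 : R = 0 := by
      rw [matInner_allOnes, eq_comm, Fintype.sum_eq_zero_iff_of_nonneg
        fun i => Finset.sum_nonneg fun j _ => hnn i j] at h
      ext i j
      have hi := congrFun h i
      simp only [Pi.zero_apply] at hi
      rw [Fintype.sum_eq_zero_iff_of_nonneg fun j => hnn i j] at hi
      exact congrFun hi j
    simp [hR0, matInner]
  · have := hY.2 _ (smul_mem_dnnFeasible hR hnn h)
    rwa [matInner_smul, le_inv_mul_iff₀ h] at this

theorem Matrix.eq_zero_of_rank_eq_zero {Y : Matrix ι ι ℝ} (h : Y.rank = 0) : Y = 0 := by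
  classical
  rw [Matrix.rank, Submodule.finrank_eq_zero, LinearMap.range_eq_bot] at h
  ext i j
  simpa using congrFun (LinearMap.congr_fun h (Pi.single j 1)) i

/-- When the DNN problem of size at most four has a unique optimizer, its rank is one. -/
theorem IsDNNOptimizer.rank_eq_one (hcard : Fintype.card ι ≤ 4)
    {Z Y : Matrix ι ι ℝ} (hY : IsDNNOptimizer Z Y)
    (huniq : ∀ X, IsDNNOptimizer Z X → X = Y) : Y.rank = 1 := by
  have hne : Y ≠ 0 := by
    rintro rfl
    simpa [matInner] using hY.1.1
  obtain ⟨w, hw0, hwne, hsupp⟩ := exists_mulVec_supported_on_clique hcard hY.1.2.1 hY.1.2.2 hne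
  obtain ⟨ε, hε, hR, hRnn⟩ := exists_sub_smul_vecMulVec_doublyNonneg hY.1.2.1 hY.1.2.2 w hsupp
  set x := Y *ᵥ w
  set V := vecMulVec x x
  have hV : V.PosSemidef := by simpa using posSemidef_vecMulVec_self_star x
  have hVnn : ∀ i j, 0 ≤ V i j := fun i j => mul_nonneg (hw0 i) (hw0 j)
  have hsum : Y = ε • V + (Y - ε • V) := by abel
  have hE : 0 < matInner (allOnes ι) V := by
    obtain ⟨i, hi⟩ := Function.ne_iff.1 hwne
    have hi : 0 < x i := (hw0 i).lt_of_ne (Ne.symm hi)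
    rw [matInner_allOnes]
    exact Finset.sum_pos' (fun i _ => Finset.sum_nonneg fun j _ => hVnn i j)
      ⟨i, Finset.mem_univ _, Finset.sum_pos' (fun j _ => hVnn i j)
        ⟨i, Finset.mem_univ _, mul_pos hi hi⟩⟩
  have h1 := hY.mul_le_matInner hV hVnn
  have h2 := hY.mul_le_matInner hR hRnn
  have h3 : matInner (allOnes ι) Y = ε * matInner (allOnes ι) V
      + matInner (allOnes ι) (Y - ε • V) := by
    conv_lhs => rw [hsum]
    rw [matInner_add, matInner_smul]
  have h4 : matInner Z Y = ε * matInner Z V + matInner Z (Y - ε • V) := by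
    conv_lhs => rw [hsum]
    rw [matInner_add, matInner_smul]
  rw [hY.1.1] at h3
  have h5 : matInner Z V ≤ matInner (allOnes ι) V * matInner Z Y := by
    refine le_of_mul_le_mul_left ?_ hε
    have h6 : matInner (allOnes ι) (Y - ε • V) = 1 - ε * matInner (allOnes ι) V := by linarith
    rw [h6] at h2
    linarith
  have hopt : IsDNNOptimizer Z ((matInner (allOnes ι) V)⁻¹ • V) := by
    refine ⟨smul_mem_dnnFeasible hV hVnn hE, fun X hX => le_trans ?_ (hY.2 X hX)⟩
    rwa [matInner_smul, inv_mul_le_iff₀ hE]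
  refine le_antisymm ?_ (Nat.one_le_iff_ne_zero.2 fun h => hne (Matrix.eq_zero_of_rank_eq_zero h))
  rw [← huniq _ hopt, ← smul_vecMulVec]
  exact rank_vecMulVec_le _ _

end DoublyNonnegative

theorem MeasureTheory.Measure.AbsolutelyContinuous.pi_fin {n : ℕ} {μ ν : Fin n → Measure ℝ}
    [∀ i, SigmaFinite (μ i)] [∀ i, SigmaFinite (ν i)] (h : ∀ i, μ i ≪ ν i) :
    Measure.pi μ ≪ Measure.pi ν := by
  induction n with
  | zero => rw [Measure.pi_of_empty μ, Measure.pi_of_empty ν]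
  | succ n ih =>
    rw [← (measurePreserving_piFinSuccAbove μ 0).symm.map_eq,
      ← (measurePreserving_piFinSuccAbove ν 0).symm.map_eq]
    exact ((h 0).prod (ih fun i => h _)).map (MeasurableEquiv.measurable _)

theorem MeasureTheory.Measure.AbsolutelyContinuous.pi {κ : Type*} [Fintype κ]
    {μ ν : κ → Measure ℝ} [∀ i, SigmaFinite (μ i)] [∀ i, SigmaFinite (ν i)]
    (h : ∀ i, μ i ≪ ν i) : Measure.pi μ ≪ Measure.pi ν := by
  let e := (Fintype.equivFin κ).symm
  rw [← (measurePreserving_piCongrLeft μ e).map_eq, ← (measurePreserving_piCongrLeft ν e).map_eq]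
  exact (Measure.AbsolutelyContinuous.pi_fin fun i => h (e i)).map (MeasurableEquiv.measurable _)

/-- For almost every `v`, all minimizers over `K` of the pairing with `v` are the same
functional: the minimum is a Lipschitz function of `v`, so Rademacher's theorem applies. -/
theorem ae_eq_of_minimizers {V α : Type*} [NormedAddCommGroup V] [NormedSpace ℝ V]
    [FiniteDimensional ℝ V] [MeasurableSpace V] [BorelSpace V] (μ : Measure V)
    [μ.IsAddHaarMeasure] (K : Set α) (B : α → V →L[ℝ] ℝ) (C : NNReal)
    (hC : ∀ y ∈ K, ‖B y‖ ≤ C) (hmin : ∀ v, ∃ y ∈ K, ∀ x ∈ K, B y v ≤ B x v) :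
    ∀ᵐ v ∂μ, ∀ y ∈ K, ∀ y' ∈ K, (∀ x ∈ K, B y v ≤ B x v) → (∀ x ∈ K, B y' v ≤ B x v) →
      B y = B y' := by
  choose m hmK hm using hmin
  set f : V → ℝ := fun v => B (m v) v
  have hf : LipschitzWith C f := by
    refine LipschitzWith.of_le_add_mul C fun u v => ?_
    have h1 : B (m v) u = B (m v) v + B (m v) (u - v) := by simp
    have h2 : B (m v) (u - v) ≤ C * dist u v := by
      rw [dist_eq_norm]
      exact (le_abs_self _).trans (((B (m v)).le_opNorm _).trans (by gcongr; exact hC _ (hmK v)))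
    have h3 := hm u (m v) (hmK v)
    simp only [f]
    linarith
  filter_upwards [hf.ae_differentiableAt (μ := μ)] with v hv
  have key : ∀ y ∈ K, (∀ x ∈ K, B y v ≤ B x v) → B y = fderiv ℝ f v := fun y hy hyv => by
    have hloc : IsLocalMin (fun u => B y u - f u) v := by
      refine Filter.Eventually.of_forall fun u => ?_
      have h1 := hyv (m v) (hmK v)
      have h2 := hm u y hy
      simp only [f]
      linarith
    exact sub_eq_zero.1 (hloc.hasFDerivAt_eq_zero ((B y).hasFDerivAt.sub hv.hasFDerivAt))
  intro y hy y' hy' h h'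
  rw [key y hy h, key y' hy' h']

section Compactness

variable {ι : Type*} [Fintype ι]

theorem continuous_matInner (Z : Matrix ι ι ℝ) : Continuous (matInner Z) := by
  unfold matInner
  fun_prop

theorem isCompact_dnnFeasible : IsCompact (dnnFeasible ι) := by
  have hsub : dnnFeasible ι ⊆ Set.univ.pi fun _ : ι => Set.univ.pi fun _ : ι => Set.Icc 0 1 := by
    intro Y hY i _ j _
    refine ⟨hY.2.2 i j, ?_⟩
    rw [← hY.1, matInner_allOnes]
    exact (Finset.single_le_sum (fun j _ => hY.2.2 i j) (Finset.mem_univ j)).trans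
      (Finset.single_le_sum (f := fun i => ∑ j, Y i j)
        (fun i _ => Finset.sum_nonneg fun j _ => hY.2.2 i j) (Finset.mem_univ i))
  refine IsCompact.of_isClosed_subset
    (isCompact_univ_pi fun _ => isCompact_univ_pi fun _ => isCompact_Icc) ?_ hsub
  have hcl : dnnFeasible ι = {Y | matInner (allOnes ι) Y = 1} ∩ ({Y | Y.conjTranspose = Y} ∩
      ⋂ x : ι → ℝ, {Y : Matrix ι ι ℝ | 0 ≤ star x ⬝ᵥ Y.mulVec x}) ∩
      ⋂ i, ⋂ j, {Y : Matrix ι ι ℝ | 0 ≤ Y i j} := by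
    ext Y
    simp [dnnFeasible, Matrix.posSemidef_iff_dotProduct_mulVec, Matrix.IsHermitian, and_assoc]
  rw [hcl]
  refine ((isClosed_eq (continuous_matInner _) continuous_const).inter
    ((isClosed_eq (by fun_prop) continuous_id).inter (isClosed_iInter fun x => ?_))).inter
    (isClosed_iInter fun i => isClosed_iInter fun j => ?_)
  · exact isClosed_le continuous_const (by fun_prop)
  · exact isClosed_le continuous_const (by fun_prop)

theorem dnnFeasible_nonempty [Nonempty ι] : (dnnFeasible ι).Nonempty := by
  have h : (Matrix.vecMulVec (1 : ι → ℝ) 1).PosSemidef := by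
    simpa using Matrix.posSemidef_vecMulVec_self_star (1 : ι → ℝ)
  refine ⟨_, smul_mem_dnnFeasible h (by simp [Matrix.vecMulVec_apply]) ?_⟩
  rw [matInner_allOnes]
  simp [Matrix.vecMulVec_apply, Fintype.card_pos]

theorem exists_isDNNOptimizer [Nonempty ι] (Z : Matrix ι ι ℝ) : ∃ Y, IsDNNOptimizer Z Y :=
  isCompact_dnnFeasible.exists_isMinOn dnnFeasible_nonempty (continuous_matInner Z).continuousOn

end Compactness

/-- If the entries of a random symmetric matrix are read off a vector of coordinates which are
shared only by symmetric positions, then the DNN problem has almost surely at most one optimizer. -/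
theorem ae_subsingleton_isDNNOptimizer {ι κ : Type*} [Fintype ι] [Nonempty ι] [Fintype κ]
    (idx : ι → ι → κ)
    (hidx : ∀ D : Matrix ι ι ℝ, D.IsSymm → ∃ h : κ → ℝ, ∀ i j, h (idx i j) = D i j) :
    ∀ᵐ q : κ → ℝ, ∀ Y Y', IsDNNOptimizer (Matrix.of fun i j => q (idx i j)) Y →
      IsDNNOptimizer (Matrix.of fun i j => q (idx i j)) Y' → Y = Y' := by
  let B : Matrix ι ι ℝ → (κ → ℝ) →L[ℝ] ℝ := fun Y =>
    ∑ i, ∑ j, Y i j • ContinuousLinearMap.proj (idx i j)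
  have hB : ∀ Y q, B Y q = matInner (Matrix.of fun i j => q (idx i j)) Y := fun Y q => by
    simp [B, matInner, mul_comm]
  have hnorm : ∀ Y ∈ dnnFeasible ι, ‖B Y‖ ≤ (1 : NNReal) := fun Y hY => by
    refine ContinuousLinearMap.opNorm_le_bound _ zero_le_one fun q => ?_
    rw [hB, NNReal.coe_one, ← hY.1, matInner_allOnes, Finset.sum_mul]
    refine (norm_sum_le _ _).trans (Finset.sum_le_sum fun i _ => ?_)
    rw [Finset.sum_mul]
    refine (norm_sum_le _ _).trans (Finset.sum_le_sum fun j _ => ?_)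
    rw [norm_mul, mul_comm, Real.norm_of_nonneg (hY.2.2 i j)]
    exact mul_le_mul_of_nonneg_left (norm_le_pi_norm q _) (hY.2.2 i j)
  filter_upwards [ae_eq_of_minimizers volume (dnnFeasible ι) B 1 hnorm fun q => by
    simpa only [hB, IsDNNOptimizer] using
      exists_isDNNOptimizer (Matrix.of fun i j => q (idx i j))] with q hq Y Y' hY hY'
  have hBB := hq Y hY.1 Y' hY'.1 (by simpa only [hB] using hY.2) (by simpa only [hB] using hY'.2)
  have hsY : ∀ {X : Matrix ι ι ℝ}, X ∈ dnnFeasible ι → X.IsSymm := fun hX => by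
    simpa [Matrix.IsHermitian, Matrix.IsSymm] using hX.2.1.isHermitian
  obtain ⟨h, hh⟩ := hidx (Y - Y') ((hsY hY.1).sub (hsY hY'.1))
  have hz : matInner (Y - Y') (Y - Y') = 0 := by
    have hM : (Matrix.of fun i j => h (idx i j)) = Y - Y' := by ext i j; exact hh i j
    have := congrArg (fun F => F h) hBB
    simp only [hB, hM] at this
    rw [sub_eq_add_neg Y Y', matInner_add, ← sub_eq_add_neg, ← neg_one_smul ℝ Y', matInner_smul,
      this]
    ring
  ext i j
  have h1 := (Finset.sum_eq_zero_iff_of_nonneg fun i _ => Finset.sum_nonneg fun j _ =>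
    mul_self_nonneg _).1 hz i (Finset.mem_univ i)
  have h2 := (Finset.sum_eq_zero_iff_of_nonneg fun j _ => mul_self_nonneg _).1 h1 j
    (Finset.mem_univ j)
  simpa [sub_eq_zero] using h2

theorem IsMatrixGenerator.map_absolutelyContinuous {Ω : Type*} [MeasurableSpace Ω]
    {P : Measure Ω} [IsProbabilityMeasure P] {n : ℕ} {Q : Ω → Matrix (Fin n) (Fin n) ℝ}
    {lawD lawO : Measure ℝ} (hQ : IsMatrixGenerator P Q lawD lawO) :
    P.map (fun ω (p : {p : Fin n × Fin n // p.1 ≤ p.2}) => Q ω p.1.1 p.1.2) ≪ volume := by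
  have hmeas : ∀ p : {p : Fin n × Fin n // p.1 ≤ p.2}, AEMeasurable (fun ω => Q ω p.1.1 p.1.2) P :=
    fun p => (hQ.measurable_entry _ _).aemeasurable
  have : ∀ p : {p : Fin n × Fin n // p.1 ≤ p.2},
      IsProbabilityMeasure (P.map fun ω => Q ω p.1.1 p.1.2) :=
    fun p => Measure.isProbabilityMeasure_map (hmeas p)
  rw [(iIndepFun_iff_map_fun_eq_pi_map hmeas).1 hQ.indep]
  refine Measure.AbsolutelyContinuous.pi fun p => ?_
  rcases p.2.eq_or_lt with h | h
  · rw [← h, hQ.law_diag]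
    exact hQ.ac_diag
  · rw [hQ.law_offDiag _ _ h]
    exact hQ.ac_offDiag

theorem mainTheorem6 {Ω : Type*} [MeasurableSpace Ω] (P : Measure Ω) [IsProbabilityMeasure P]
    (n : ℕ) (Q : Ω → Matrix (Fin n) (Fin n) ℝ)
    (lawD lawO : Measure ℝ) [IsProbabilityMeasure lawD] [IsProbabilityMeasure lawO]
    (hQ : IsMatrixGenerator P Q lawD lawO)
    (C : Finset (Fin n)) (hC : C.Nonempty) (hcard : C.card ≤ 4) :
    ∀ᵐ ω ∂P,
      (∃! Y : Matrix C C ℝ, IsDNNOptimizer (principalSubmatrix (Q ω) C) Y) ∧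
      ∀ Y : Matrix C C ℝ, IsDNNOptimizer (principalSubmatrix (Q ω) C) Y → Y.rank = 1 := by
  have : Nonempty C := hC.to_subtype
  let idx : C → C → {p : Fin n × Fin n // p.1 ≤ p.2} := fun i j =>
    ⟨(min i.1 j.1, max i.1 j.1), min_le_max⟩
  have hidx : ∀ D : Matrix C C ℝ, D.IsSymm →
      ∃ h : {p : Fin n × Fin n // p.1 ≤ p.2} → ℝ, ∀ i j, h (idx i j) = D i j := fun D hD => by
    refine ⟨fun p => if hp : p.1.1 ∈ C ∧ p.1.2 ∈ C then D ⟨_, hp.1⟩ ⟨_, hp.2⟩ else 0,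
      fun i j => ?_⟩
    rcases le_total i.1 j.1 with h | h
    · simp [idx, h]
    · simp [idx, h, hD.apply]
  have hmeas : Measurable fun ω (p : {p : Fin n × Fin n // p.1 ≤ p.2}) => Q ω p.1.1 p.1.2 :=
    measurable_pi_lambda _ fun p => hQ.measurable_entry _ _
  filter_upwards [ae_of_ae_map hmeas.aemeasurable
    (hQ.map_absolutelyContinuous.ae_le (ae_subsingleton_isDNNOptimizer idx hidx))] with ω hω
  have hM : (Matrix.of fun i j : C => Q ω (idx i j).1.1 (idx i j).1.2)
      = principalSubmatrix (Q ω) C := by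
    ext i j
    rcases le_total i.1 j.1 with h | h
    · simp [idx, h, principalSubmatrix]
    · simp [idx, h, principalSubmatrix, (hQ.symm ω).apply]
  rw [hM] at hω
  obtain ⟨Y, hY⟩ := exists_isDNNOptimizer (principalSubmatrix (Q ω) C)
  refine ⟨⟨Y, hY, fun X hX => hω X Y hX hY⟩, fun X hX => ?_⟩
  exact hX.rank_eq_one (by simpa using hcard) fun X' hX' => hω X' X hX' hX
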